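/- Throughout, a super-ring is a $\mathbb Z/2$-graded unital ring $R=R_0\oplus R_1$ that is super-commutative: elements of $R_0$ commute with all elements of $R_0$ and of $R_1$, and $y^2=0$ for every $y\in R_1$. A super-ideal is a homogeneous ideal; it is maximal if the quotient by it is a field. $R$ is Noetherian if its super-ideals satisfy the ascending chain condition, and local if it has exactly one maximal super-ideal. For a super-ideal $I$, the $I$-adic completion is the super-ring $\widehat R=\varprojlim_n R/I^n$, where $\widehat R_i$ consists of the families all of whose components are represented by elements of $R_i$. Let $R$ be a Noetherian super-ring with $\mathrm{Kdim}(R_0)<\infty$, where $\mathrm{Kdim}$ is the Krull dimension. Odd elements $y_1,\dots,y_s\in R_1$ form a system of odd parameters if $\mathrm{Kdim}(R_0)=\mathrm{Kdim}\bigl(R_0/\mathrm{Ann}_{R_0}(y_1\cdots y_s)\bigr)$, where $\mathrm{Ann}_{R_0}(x)=\{r\in R_0 : rx=0\}$ (for $s=0$ the product is $1$). The Krull super-dimension is $\mathrm{Ksdim}(R)=r\mid s$, where the even Krull dimension $r=\mathrm{Ksdim}_0(R)=\mathrm{Kdim}(R_0)$ and the odd Krull dimension $s=\mathrm{Ksdim}_1(R)$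 is the largest length of a system of odd parameters of $R$. **Theorem.** Let $A$ be a local Noetherian super-ring with maximal super-ideal $\mathfrak m$, and let $\widehat A$ be its $\mathfrak m$-adic completion. Then $\widehat A$ is Noetherian, $\mathrm{Ksdim}(A)$ is a pair of non-negative integers (so that both super-dimensions are defined), and $$\mathrm{Ksdim}(A)=\mathrm{Ksdim}(\widehat A),$$ that is, $\mathrm{Ksdim}_0(A)=\mathrm{Ksdim}_0(\widehat A)$ and $\mathrm{Ksdim}_1(A)=\mathrm{Ksdim}_1(\widehat A)$. -/

import Mathlib

/-- A `ℤ/2`-graded ring `A = A₀ ⊕ A₁` is super-commutative if even elements commute with all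
homogeneous elements and odd elements square to zero. -/
class IsSuperCommutative {A : Type*} [Ring A] (𝒜 : ZMod 2 → AddSubgroup A) [GradedRing 𝒜] :
    Prop where
  even_mul_even : ∀ r ∈ 𝒜 0, ∀ s ∈ 𝒜 0, r * s = s * r
  even_mul_odd : ∀ r ∈ 𝒜 0, ∀ s ∈ 𝒜 1, r * s = s * r
  odd_mul_self : ∀ s ∈ 𝒜 1, s * s = 0

namespace SuperRing

section Basic

variable {A : Type*} [Ring A] (𝒜 : ZMod 2 → AddSubgroup A) [GradedRing 𝒜]

theorem zmod_two_cases (i : ZMod 2) : i = 0 ∨ i = 1 := by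
  revert i; decide

theorem proj_add_proj (a : A) : GradedRing.proj 𝒜 0 a + GradedRing.proj 𝒜 1 a = a := by
  classical
  have h := DirectSum.sum_support_decompose 𝒜 a
  rw [Finset.sum_subset (Finset.subset_univ _)] at h
  · exact (Fin.sum_univ_two
      (fun i : ZMod 2 => ((DirectSum.decompose 𝒜 a i : 𝒜 i) : A))).symm.trans h
  · intro i _ hi
    simpa using hi

theorem proj_mem (i : ZMod 2) (a : A) : GradedRing.proj 𝒜 i a ∈ 𝒜 i :=
  SetLike.coe_mem (DirectSum.decompose 𝒜 a i)

variable {𝒜} in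
theorem pow_isHomogeneous (I : HomogeneousIdeal 𝒜) (n : ℕ) : (I.toIdeal ^ n).IsHomogeneous 𝒜 := by
  induction n with
  | zero =>
    intro i a _
    rw [Submodule.pow_zero, Ideal.one_eq_top]
    exact Submodule.mem_top
  | succ n ih =>
    intro i a ha
    change GradedRing.proj 𝒜 i a ∈ I.toIdeal ^ (n + 1)
    rw [Submodule.pow_succ] at ha ⊢
    refine Submodule.smul_induction_on (p := fun a => GradedRing.proj 𝒜 i a ∈ _) ha ?_ ?_
    · intro r hr x hx
      rw [smul_eq_mul, ← proj_add_proj 𝒜 x, mul_add, map_add]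
      have key : ∀ j, GradedRing.proj 𝒜 i (r * GradedRing.proj 𝒜 j x)
          ∈ I.toIdeal ^ n * I.toIdeal := by
        intro j
        have hxj : GradedRing.proj 𝒜 j x ∈ I.toIdeal := I.isHomogeneous j hx
        rw [← proj_add_proj 𝒜 r, add_mul, map_add]
        have key2 : ∀ k, GradedRing.proj 𝒜 i (GradedRing.proj 𝒜 k r * GradedRing.proj 𝒜 j x)
            ∈ I.toIdeal ^ n * I.toIdeal := by
          intro k
          have hrk : GradedRing.proj 𝒜 k r ∈ I.toIdeal ^ n := ih k hr
          have hm : GradedRing.proj 𝒜 k r * GradedRing.proj 𝒜 j x ∈ 𝒜 (k + j) :=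
            SetLike.mul_mem_graded (proj_mem 𝒜 k r) (proj_mem 𝒜 j x)
          by_cases h : k + j = i
          · subst h
            rw [GradedRing.proj_apply, DirectSum.decompose_of_mem_same 𝒜 hm]
            exact Ideal.mul_mem_mul hrk hxj
          · rw [GradedRing.proj_apply, DirectSum.decompose_of_mem_ne 𝒜 hm h]
            exact zero_mem _
        exact add_mem (key2 0) (key2 1)
      exact add_mem (key 0) (key 1)
    · intro x y hx hy
      rw [map_add]
      exact add_mem hx hy

variable {𝒜} in
theorem even_comm [IsSuperCommutative 𝒜] {r : A} (hr : r ∈ 𝒜 0) (a : A) : r * a = a * r := by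
  rw [← proj_add_proj 𝒜 a, mul_add, add_mul,
    IsSuperCommutative.even_mul_even r hr _ (proj_mem 𝒜 0 a),
    IsSuperCommutative.even_mul_odd r hr _ (proj_mem 𝒜 1 a)]

variable {𝒜} in
theorem odd_anticomm [IsSuperCommutative 𝒜] {r s : A} (hr : r ∈ 𝒜 1) (hs : s ∈ 𝒜 1) :
    r * s = -(s * r) := by
  have h := IsSuperCommutative.odd_mul_self (𝒜 := 𝒜) (r + s) ((𝒜 1).add_mem hr hs)
  have h1 := IsSuperCommutative.odd_mul_self (𝒜 := 𝒜) r hr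
  have h2 := IsSuperCommutative.odd_mul_self (𝒜 := 𝒜) s hs
  rw [add_mul, mul_add, mul_add, h1, h2, zero_add, add_zero] at h
  exact eq_neg_of_add_eq_zero_left h

/-- The even part `A₀`, as a subring of `A`. -/
def evenPart : Subring A := SetLike.GradeZero.subring 𝒜

theorem mem_evenPart {a : A} : a ∈ evenPart 𝒜 ↔ a ∈ 𝒜 0 := Iff.rfl

instance evenPart.instCommRing [IsSuperCommutative 𝒜] : CommRing (evenPart 𝒜) :=
  { (inferInstance : Ring (evenPart 𝒜)) with
    mul_comm := fun a b => Subtype.ext (even_comm (𝒜 := 𝒜) a.2 b.1) }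

/-- A super-ring is Noetherian if its super-ideals (homogeneous ideals) satisfy the ascending
chain condition. -/
def IsNoetherianSuper : Prop := WellFoundedGT (HomogeneousIdeal 𝒜)

variable {𝒜} in
/-- Super-ideals of a super-commutative super-ring are two-sided. -/
instance instIsTwoSided [IsSuperCommutative 𝒜] (I : HomogeneousIdeal 𝒜) :
    I.toIdeal.IsTwoSided := by
  refine ⟨fun {a} b ha => ?_⟩
  have h0 : GradedRing.proj 𝒜 0 a ∈ I.toIdeal := I.isHomogeneous 0 ha
  have h1 : GradedRing.proj 𝒜 1 a ∈ I.toIdeal := I.isHomogeneous 1 ha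
  rw [← proj_add_proj 𝒜 a, ← proj_add_proj 𝒜 b, add_mul, mul_add, mul_add,
    even_comm (proj_mem 𝒜 0 a), even_comm (proj_mem 𝒜 0 a),
    ← even_comm (proj_mem 𝒜 0 b) (GradedRing.proj 𝒜 1 a),
    odd_anticomm (proj_mem 𝒜 1 a) (proj_mem 𝒜 1 b)]
  exact add_mem (add_mem (Ideal.mul_mem_left _ _ h0) (Ideal.mul_mem_left _ _ h0))
    (add_mem (Ideal.mul_mem_left _ _ h1) (neg_mem (Ideal.mul_mem_left _ _ h1)))

variable {𝒜} in
/-- A super-ideal `𝔪` is maximal if the quotient ring `A / 𝔪` is a field. -/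
def IsMaximalSuperIdeal [IsSuperCommutative 𝒜] (m : HomogeneousIdeal 𝒜) : Prop :=
  IsField (A ⧸ m.toIdeal)

/-- `A` is a local super-ring with (unique) maximal super-ideal `𝔪`. -/
def IsLocalWith [IsSuperCommutative 𝒜] (m : HomogeneousIdeal 𝒜) : Prop :=
  IsMaximalSuperIdeal m ∧ ∀ n : HomogeneousIdeal 𝒜, IsMaximalSuperIdeal n → n = m

section KrullSuperDimension

variable [IsSuperCommutative 𝒜]

/-- `Ann_{A₀}(x)`, the ideal of all `r ∈ A₀` with `r x = 0`. -/
def evenAnn (x : A) : Ideal (evenPart 𝒜) where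
  carrier := {r | (r : A) * x = 0}
  add_mem' := by
    intro a b ha hb
    change ((a : A) + b) * x = 0
    rw [add_mul, show (a : A) * x = 0 from ha, show (b : A) * x = 0 from hb, add_zero]
  zero_mem' := zero_mul x
  smul_mem' := by
    intro c a ha
    change ((c : A) * a) * x = 0
    rw [mul_assoc, show (a : A) * x = 0 from ha, mul_zero]

/-- The odd elements `y₁, …, yₛ` form a system of odd parameters:
`Kdim A₀ = Kdim (A₀ / Ann_{A₀}(y₁ ⋯ yₛ))`. -/
def IsSystemOfOddParameters {s : ℕ} (y : Fin s → A) : Prop :=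
  (∀ i, y i ∈ 𝒜 1) ∧
    ringKrullDim (evenPart 𝒜) =
      ringKrullDim (evenPart 𝒜 ⧸ evenAnn 𝒜 (List.ofFn y).prod)

/-- The even Krull dimension `Ksdim₀(A) = Kdim(A₀)`. -/
noncomputable def evenKrullDim : WithBot ℕ∞ := ringKrullDim (evenPart 𝒜)

/-- The odd Krull dimension `Ksdim₁(A)`: the largest length of a system of odd parameters
(as a supremum in `ℕ∞`; the empty system always qualifies). -/
noncomputable def oddKrullDim : ℕ∞ :=
  ⨆ (s : ℕ) (_ : ∃ y : Fin s → A, IsSystemOfOddParameters 𝒜 y), (s : ℕ∞)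

/-- The Krull super-dimension `Ksdim(A) = r | s`. -/
noncomputable def Ksdim : WithBot ℕ∞ × ℕ∞ := (evenKrullDim 𝒜, oddKrullDim 𝒜)

end KrullSuperDimension

end Basic

section Completion

variable {A : Type*} [Ring A] {𝒜 : ZMod 2 → AddSubgroup A} [GradedRing 𝒜] [IsSuperCommutative 𝒜]
  (I : HomogeneousIdeal 𝒜)

/-- The subring of compatible families in `∏ₙ A / Iⁿ`. -/
def completionSubring : Subring (∀ n : ℕ, A ⧸ I.toIdeal ^ n) where
  carrier := {x | ∀ m n : ℕ, ∀ h : m ≤ n,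
    Ideal.Quotient.factor (Ideal.pow_le_pow_right h) (x n) = x m}
  mul_mem' := fun hx hy m n h => by simp [hx m n h, hy m n h]
  one_mem' := fun m n h => by simp
  add_mem' := fun hx hy m n h => by simp [hx m n h, hy m n h]
  zero_mem' := fun m n h => by simp
  neg_mem' := fun hx m n h => by simp [hx m n h]

/-- The `I`-adic completion `lim A / Iⁿ` of a super-ring along a super-ideal `I`. -/
def Completion : Type _ := completionSubring I

instance Completion.instRing : Ring (Completion I) :=
  inferInstanceAs (Ring (completionSubring I))

/-- The grading of the completion: `x` has degree `i` if each component `xₙ ∈ A / Iⁿ` is the class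
of an element of `Aᵢ`. -/
def completionGrading (i : ZMod 2) : AddSubgroup (Completion I) where
  carrier := {x | ∀ n, ∃ a ∈ 𝒜 i, Ideal.Quotient.mk (I.toIdeal ^ n) a = x.1 n}
  add_mem' := by
    intro x y hx hy n
    obtain ⟨a, ha, hax⟩ := hx n
    obtain ⟨b, hb, hby⟩ := hy n
    exact ⟨a + b, add_mem ha hb, by rw [map_add, hax, hby]; rfl⟩
  zero_mem' := fun n => ⟨0, zero_mem _, map_zero (Ideal.Quotient.mk (I.toIdeal ^ n))⟩
  neg_mem' := by
    intro x hx n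
    obtain ⟨a, ha, hax⟩ := hx n
    exact ⟨-a, neg_mem ha, by rw [map_neg, hax]; rfl⟩

theorem completionGrading_disjoint {x : Completion I} (h0 : x ∈ completionGrading I 0)
    (h1 : x ∈ completionGrading I 1) : x = 0 := by
  refine Subtype.ext (funext fun n => ?_)
  obtain ⟨a, ha, hax⟩ := h0 n
  obtain ⟨b, hb, hbx⟩ := h1 n
  have hab : a - b ∈ I.toIdeal ^ n := Ideal.Quotient.eq.1 (hax.trans hbx.symm)
  have hp : GradedRing.proj 𝒜 0 (a - b) ∈ I.toIdeal ^ n := pow_isHomogeneous I n 0 hab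
  rw [map_sub, GradedRing.proj_apply, GradedRing.proj_apply,
    DirectSum.decompose_of_mem_same 𝒜 ha,
    DirectSum.decompose_of_mem_ne 𝒜 hb (by decide), sub_zero] at hp
  rw [← hax, Ideal.Quotient.eq_zero_iff_mem.2 hp]
  rfl

theorem exists_completionGrading_add (x : Completion I) :
    ∃ x0 ∈ completionGrading I 0, ∃ x1 ∈ completionGrading I 1, x0 + x1 = x := by
  choose a ha using fun n => Ideal.Quotient.mk_surjective (x.1 n)
  have hc : ∀ i : ZMod 2, (fun n => Ideal.Quotient.mk (I.toIdeal ^ n) (GradedRing.proj 𝒜 i (a n)))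
      ∈ completionSubring I := by
    intro i m n h
    rw [Ideal.Quotient.factor_mk, Ideal.Quotient.eq, ← map_sub]
    refine pow_isHomogeneous I m i (Ideal.Quotient.eq.1 ?_)
    rw [ha m, ← x.2 m n h, ← ha n, Ideal.Quotient.factor_mk]
  refine ⟨⟨_, hc 0⟩, fun n => ⟨_, proj_mem 𝒜 0 (a n), rfl⟩,
    ⟨_, hc 1⟩, fun n => ⟨_, proj_mem 𝒜 1 (a n), rfl⟩, Subtype.ext (funext fun n => ?_)⟩
  change Ideal.Quotient.mk (I.toIdeal ^ n) (GradedRing.proj 𝒜 0 (a n))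
    + Ideal.Quotient.mk (I.toIdeal ^ n) (GradedRing.proj 𝒜 1 (a n)) = x.1 n
  rw [← map_add, proj_add_proj, ha]

instance completionGrading.instGradedMonoid : SetLike.GradedMonoid (completionGrading I) where
  one_mem := fun n => ⟨1, SetLike.one_mem_graded 𝒜, map_one _⟩
  mul_mem := by
    intro i j x y hx hy n
    obtain ⟨a, ha, hax⟩ := hx n
    obtain ⟨b, hb, hby⟩ := hy n
    exact ⟨a * b, SetLike.mul_mem_graded ha hb, by rw [map_mul, hax, hby]; rfl⟩

theorem completionGrading_isInternal : DirectSum.IsInternal (completionGrading I) := by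
  have hsplit : ∀ f : DirectSum (ZMod 2) fun i => completionGrading I i,
      f = DirectSum.of (fun i => completionGrading I i) 0 (f 0)
        + DirectSum.of (fun i => completionGrading I i) 1 (f 1) := by
    intro f
    refine DFinsupp.ext fun i => ?_
    rcases zmod_two_cases i with rfl | rfl
    · rw [DirectSum.add_apply, DirectSum.of_eq_same, DirectSum.of_eq_of_ne _ _ _ (by decide),
        add_zero]
    · rw [DirectSum.add_apply, DirectSum.of_eq_same, DirectSum.of_eq_of_ne _ _ _ (by decide),
        zero_add]
  constructor
  · rw [injective_iff_map_eq_zero]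
    intro f hf
    rw [hsplit f, map_add, DirectSum.coeAddMonoidHom_of, DirectSum.coeAddMonoidHom_of] at hf
    have e0 := eq_neg_of_add_eq_zero_left hf
    have h0 := completionGrading_disjoint I (f 0).2
      (e0.symm ▸ (completionGrading I 1).neg_mem (f 1).2)
    rw [h0, zero_add] at hf
    have k0 : f 0 = 0 := Subtype.ext h0
    have k1 : f 1 = 0 := Subtype.ext hf
    refine DFinsupp.ext fun i => ?_
    rcases zmod_two_cases i with rfl | rfl
    · exact k0
    · exact k1
  · intro x
    obtain ⟨x0, h0, x1, h1, hx⟩ := exists_completionGrading_add I x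
    refine ⟨DirectSum.of (fun i => completionGrading I i) 0 ⟨x0, h0⟩
      + DirectSum.of (fun i => completionGrading I i) 1 ⟨x1, h1⟩, ?_⟩
    rw [map_add, DirectSum.coeAddMonoidHom_of, DirectSum.coeAddMonoidHom_of]
    exact hx

noncomputable instance completionGrading.instDecomposition :
    DirectSum.Decomposition (completionGrading I) :=
  (completionGrading_isInternal I).chooseDecomposition

/-- The completion is again a super-ring. -/
noncomputable instance completionGrading.instGradedRing : GradedRing (completionGrading I) where
  toGradedMonoid := completionGrading.instGradedMonoid I
  toDecomposition := completionGrading.instDecomposition I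

/-- The completion is again super-commutative. -/
instance completionGrading.instIsSuperCommutative : IsSuperCommutative (completionGrading I) where
  even_mul_even := by
    intro x hx y hy
    refine Subtype.ext (funext fun n => ?_)
    obtain ⟨a, ha, hax⟩ := hx n
    obtain ⟨b, hb, hby⟩ := hy n
    change x.1 n * y.1 n = y.1 n * x.1 n
    rw [← hax, ← hby, ← map_mul, ← map_mul, even_comm ha]
  even_mul_odd := by
    intro x hx y hy
    refine Subtype.ext (funext fun n => ?_)
    obtain ⟨a, ha, hax⟩ := hx n
    obtain ⟨b, hb, hby⟩ := hy n
    change x.1 n * y.1 n = y.1 n * x.1 n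
    rw [← hax, ← hby, ← map_mul, ← map_mul, even_comm ha]
  odd_mul_self := by
    intro x hx
    refine Subtype.ext (funext fun n => ?_)
    obtain ⟨a, ha, hax⟩ := hx n
    change x.1 n * x.1 n = 0
    rw [← hax, ← map_mul, IsSuperCommutative.odd_mul_self a ha, map_zero]

end Completion

end SuperRing

/-!
Since the odd part `A₁` is finitely generated over `A₀` and odd elements anticommute and square to
zero, `A₁` is nilpotent; hence the `𝔪`-adic topology on `A` is the `𝔞`-adic topology of the finite
`A₀`-module `A`, where `𝔞 = 𝔪 ∩ A₀` is the maximal ideal of the Noetherian local ring `A₀`. So the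
completion of `A` is `Â₀ ⊗ A`, with even part `Â₀`, and it is Noetherian. Completion is exact on
finite `A₀`-modules, hence `Ann_{Â₀}(z) = Ann_{A₀}(z) Â₀`; by flatness, `A₀ / Ann_{A₀}(z)` keeps its
dimension under completion, so odd elements of `A` form a system of odd parameters of `A` if and
only if they do so in `Â`. It remains to replace odd parameters of `Â` by elements of `A`: the odd
part of `Â` is generated over `Â₀` by generators of `A₁`. The product of `s` odd elements is a
combination of products of `s` of these, so its annihilator contains the intersection of
the annihilators of these products, and the smallest prime of a longest chain over the former must
contain one of the latter.
-/

namespace SuperRing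

section AdicCompletionRing

theorem factorPow_evalₐ {R : Type*} [CommRing R] {I : Ideal R} {m n : ℕ} (h : m ≤ n)
    (x : AdicCompletion I R) :
    Ideal.Quotient.factorPow I h (AdicCompletion.evalₐ I n x) = AdicCompletion.evalₐ I m x := by
  obtain ⟨x, rfl⟩ := AdicCompletion.mk_surjective I R x
  rw [AdicCompletion.evalₐ_mk, AdicCompletion.evalₐ_mk]
  exact AdicCompletion.Ideal.mk_eq_mk I h x

section ToQuotient

variable {P S : Type*} [CommRing P] [Ring S] {J : Ideal P} (φ : P →+* S)

/-- The homomorphism from the `J`-adic completion of `P` to a quotient `S / K`, induced by a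
homomorphism `φ : P → S` carrying `J ^ n` into `K`. -/
noncomputable def toQuotient {n : ℕ} {K : Ideal S} [K.IsTwoSided] (h : J ^ n ≤ K.comap φ) :
    AdicCompletion J P →+* S ⧸ K :=
  (Ideal.quotientMap K φ h).comp (AdicCompletion.evalₐ J n : _ →+* _)

theorem factor_toQuotient {m n : ℕ} {K L : Ideal S} [K.IsTwoSided] [L.IsTwoSided]
    (hK : J ^ m ≤ K.comap φ) (hL : J ^ n ≤ L.comap φ) (hmn : m ≤ n) (hLK : L ≤ K)
    (x : AdicCompletion J P) :
    Ideal.Quotient.factor hLK (toQuotient φ hL x) = toQuotient φ hK x := by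
  obtain ⟨a, ha⟩ := Ideal.Quotient.mk_surjective (AdicCompletion.evalₐ J n x)
  simp [toQuotient, ← factorPow_evalₐ hmn, ← ha, Ideal.Quotient.factorPow]

theorem pow_le_comap_pow {φ : P →+* S} {I : Ideal S} (h : J.map φ ≤ I) (n : ℕ) :
    J ^ n ≤ (I ^ n).comap φ := by
  induction n with
  | zero =>
    rw [Submodule.pow_zero, Submodule.pow_zero, Ideal.one_eq_top, Ideal.one_eq_top, Ideal.comap_top]
  | succ n ih =>
    rw [pow_succ, Submodule.pow_succ, Ideal.mul_le]
    intro r hr s hs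
    rw [Ideal.mem_comap, map_mul]
    exact Ideal.mul_mem_mul (ih hr) (Ideal.map_le_iff_le_comap.1 h hs)

end ToQuotient

section Lift

variable {P S : Type*} [CommRing P] [CommRing S] {J : Ideal P} {I : Ideal S}

theorem factorPow_comp_toQuotient (φ : P →+* S) (h : J.map φ ≤ I) {m n : ℕ} (hmn : m ≤ n) :
    (Ideal.Quotient.factorPow I hmn).comp (toQuotient φ (pow_le_comap_pow h n)) =
      toQuotient φ (pow_le_comap_pow h m) :=
  RingHom.ext (factor_toQuotient φ _ _ hmn (Ideal.pow_le_pow_right hmn))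

variable [IsAdicComplete I S] (φ : P →+* S)

/-- The extension of a ring homomorphism `P → S` carrying `J` into `I` to the `J`-adic completion
of `P`, where `S` is `I`-adically complete. -/
noncomputable def liftAdicCompletion (h : J.map φ ≤ I) : AdicCompletion J P →+* S :=
  IsAdicComplete.liftRingHom I (fun n => toQuotient φ (pow_le_comap_pow h n))
    (factorPow_comp_toQuotient φ h)

theorem liftAdicCompletion_algebraMap (h : J.map φ ≤ I) (x : P) :
    liftAdicCompletion φ h (algebraMap P (AdicCompletion J P) x) = φ x := by
  refine IsHausdorff.eq_iff_smodEq (I := I) |>.2 fun n => ?_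
  rw [SModEq.sub_mem, smul_eq_mul, Ideal.mul_top, ← Ideal.Quotient.eq]
  exact IsAdicComplete.mk_liftRingHom I _ (factorPow_comp_toQuotient φ h) n _

theorem liftAdicCompletion_surjective (hJ : J.FG) (h : J.map φ = I)
    (hφ : Function.Surjective ((Ideal.Quotient.mk I).comp φ)) :
    Function.Surjective (liftAdicCompletion φ h.le) := by
  subst h
  have hcomp : (liftAdicCompletion φ le_rfl).comp (algebraMap P (AdicCompletion J P)) = φ :=
    RingHom.ext (liftAdicCompletion_algebraMap φ le_rfl)
  have hmap : (J.map (algebraMap P (AdicCompletion J P))).map (liftAdicCompletion φ le_rfl) =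
      J.map φ := by
    rw [Ideal.map_map, hcomp]
  have := AdicCompletion.isAdicComplete_self J hJ
  have : IsHausdorff ((J.map (algebraMap P (AdicCompletion J P))).map
      (liftAdicCompletion φ le_rfl)) S := hmap.symm ▸ inferInstanceAs (IsHausdorff (J.map φ) S)
  refine surjective_of_mk_map_comp_surjective (I := J.map (algebraMap P (AdicCompletion J P))) _ ?_
  rw [hmap]
  refine .of_comp (g := algebraMap P (AdicCompletion J P)) ?_
  rwa [← RingHom.coe_comp, RingHom.comp_assoc, hcomp]

end Lift

theorem isNoetherianRing_adicCompletion_idealOfVars (σ R : Type*) [Finite σ] [CommRing R]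
    [IsNoetherianRing R] :
    IsNoetherianRing (AdicCompletion (MvPolynomial.idealOfVars σ R) (MvPolynomial σ R)) :=
  isNoetherianRing_of_ringEquiv _ (MvPowerSeries.toAdicCompletionAlgEquiv σ R).toRingEquiv

theorem isNoetherianRing_of_isAdicComplete {R S : Type*} [CommRing R] [IsNoetherianRing R]
    [CommRing S] [Algebra R S] (I : Ideal S) [IsAdicComplete I S] (hI : I.FG)
    (h : Function.Surjective (algebraMap R (S ⧸ I))) : IsNoetherianRing S := by
  obtain ⟨n, a, ha⟩ := Submodule.fg_iff_exists_fin_generating_family.1 hI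
  have := isNoetherianRing_adicCompletion_idealOfVars (Fin n) R
  have hJ : (MvPolynomial.idealOfVars (Fin n) R).map
      (MvPolynomial.aeval (R := R) a : _ →+* S) = I := by
    rw [Ideal.map_span, ← Set.range_comp, ← ha]
    congr; funext i; simp
  refine isNoetherianRing_of_surjective _ _ _
    (liftAdicCompletion_surjective _ (MvPolynomial.idealOfVars_fg _ _) hJ fun y => ?_)
  obtain ⟨r, rfl⟩ := h y
  exact ⟨MvPolynomial.C r, by simp⟩

theorem isNoetherianRing_adicCompletion {R : Type*} [CommRing R] [IsNoetherianRing R]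
    (I : Ideal R) : IsNoetherianRing (AdicCompletion I R) := by
  have hI : I.FG := IsNoetherian.noetherian I
  have := AdicCompletion.isAdicComplete_self I hI
  refine isNoetherianRing_of_isAdicComplete (R := R)
    (I.map (algebraMap R (AdicCompletion I R))) (hI.map _) fun y => ?_
  obtain ⟨y, rfl⟩ := Ideal.Quotient.mk_surjective y
  obtain ⟨r, hr⟩ := Ideal.Quotient.mk_surjective (AdicCompletion.evalOneₐ I y)
  refine ⟨r, Ideal.Quotient.eq.2 ?_⟩
  rw [← AdicCompletion.ker_evalOneₐ_eq_map I hI]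
  change AdicCompletion.evalOneₐ I _ = 0
  rw [map_sub, ← hr, sub_eq_zero]
  rfl

end AdicCompletionRing

section Dimension

open IsLocalRing

theorem ringKrullDim_eq_of_flat {R S : Type*} [CommRing R] [IsLocalRing R] [IsNoetherianRing R]
    [CommRing S] [IsLocalRing S] [IsNoetherianRing S] [Algebra R S] [Module.Flat R S]
    (h : (maximalIdeal R).map (algebraMap R S) = maximalIdeal S) :
    ringKrullDim R = ringKrullDim S := by
  have : IsLocalHom (algebraMap R S) := ((local_hom_TFAE (algebraMap R S)).out 0 2).2 h.le
  have hfib : ((maximalIdeal S).map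
      (Ideal.Quotient.mk ((maximalIdeal R).map (algebraMap R S)))).height = 0 := by
    have : Nontrivial (S ⧸ (maximalIdeal R).map (algebraMap R S)) :=
      Ideal.Quotient.nontrivial_iff.2 (h ▸ Ideal.IsPrime.ne_top')
    rw [← h, Ideal.map_quotient_self, Ideal.height_bot]
  rw [← maximalIdeal_height_eq_ringKrullDim, ← maximalIdeal_height_eq_ringKrullDim,
    Ideal.height_eq_height_add_of_liesOver_of_hasGoingDown (maximalIdeal R) (maximalIdeal S),
    hfib, add_zero]

theorem ringKrullDim_quotient_eq_of_flat {R S : Type*} [CommRing R] [IsLocalRing R]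
    [IsNoetherianRing R] [CommRing S] [IsLocalRing S] [IsNoetherianRing S] [Algebra R S]
    [Module.Flat R S] (h : (maximalIdeal R).map (algebraMap R S) = maximalIdeal S)
    (I : Ideal R) : ringKrullDim (R ⧸ I) = ringKrullDim (S ⧸ I.map (algebraMap R S)) := by
  rcases eq_or_ne I ⊤ with rfl | hI
  · rw [Ideal.map_top, ringKrullDim_eq_bot_of_subsingleton, ringKrullDim_eq_bot_of_subsingleton]
  have hIS : I.map (algebraMap R S) ≤ maximalIdeal S :=
    h ▸ Ideal.map_mono (le_maximalIdeal hI)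
  have : Nontrivial (R ⧸ I) := Ideal.Quotient.nontrivial_iff.2 hI
  have : Nontrivial (S ⧸ I.map (algebraMap R S)) :=
    Ideal.Quotient.nontrivial_iff.2 (ne_top_of_le_ne_top Ideal.IsPrime.ne_top' hIS)
  have : Module.Flat (R ⧸ I) (S ⧸ I.map (algebraMap R S)) :=
    .of_linearEquiv (Algebra.TensorProduct.quotIdealMapEquivQuotTensor S I).toLinearEquiv
  have : IsLocalRing (R ⧸ I) := .of_surjective' _ Ideal.Quotient.mk_surjective
  have : IsLocalRing (S ⧸ I.map (algebraMap R S)) :=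
    .of_surjective' _ Ideal.Quotient.mk_surjective
  refine ringKrullDim_eq_of_flat ?_
  rw [← map_maximalIdeal_of_surjective _ Ideal.Quotient.mk_surjective,
    ← map_maximalIdeal_of_surjective _ Ideal.Quotient.mk_surjective, ← h, Ideal.map_map,
    Ideal.map_map]
  rfl

theorem ringKrullDim_quotient_eq_adicCompletion {R : Type*} [CommRing R] [IsLocalRing R]
    [IsNoetherianRing R] (I : Ideal R) : ringKrullDim (R ⧸ I) =
      ringKrullDim (AdicCompletion (maximalIdeal R) R ⧸
        I.map (algebraMap R (AdicCompletion (maximalIdeal R) R))) :=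
  have := isNoetherianRing_adicCompletion (maximalIdeal R)
  ringKrullDim_quotient_eq_of_flat AdicCompletion.maximalIdeal_eq_map.symm I

theorem exists_ringKrullDim_quotient_eq {S ι : Type*} [CommRing S] [FiniteRingKrullDim S]
    (t : Finset ι) (J : ι → Ideal S) {I : Ideal S} (hI : t.inf J ≤ I)
    (h : ringKrullDim S = ringKrullDim (S ⧸ I)) :
    ∃ i ∈ t, ringKrullDim S = ringKrullDim (S ⧸ J i) := by
  rw [ringKrullDim_quotient] at h
  have : FiniteDimensionalOrder (PrimeSpectrum.zeroLocus (I : Set S)) := by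
    rw [Order.finiteDimensionalOrder_iff_krullDim_ne_bot_and_top, ← h]
    exact ⟨ringKrullDim_ne_bot, ringKrullDim_ne_top⟩
  let c := LTSeries.longestOf (PrimeSpectrum.zeroLocus (I : Set S))
  obtain ⟨i, hi, hic⟩ := (Ideal.IsPrime.inf_le' c.head.1.2).1 (hI.trans c.head.2)
  let c' : LTSeries (PrimeSpectrum.zeroLocus (J i : Set S)) :=
    { length := c.length
      toFun := fun j => ⟨(c j).1, hic.trans (c.head_le j)⟩
      step := c.step }
  refine ⟨i, hi, le_antisymm ?_ (ringKrullDim_quotient_le _)⟩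
  rw [h, Order.krullDim_eq_length_of_finiteDimensionalOrder, ringKrullDim_quotient]
  exact Order.LTSeries.length_le_krullDim c'

end Dimension

section AdicCompletionModule

variable {R : Type*} [CommRing R] (I : Ideal R)
  {M : Type*} [AddCommGroup M] [Module R M]

theorem span_adicCompletionOf_image_span (Z : Set M) :
    Submodule.span (AdicCompletion I R) (AdicCompletion.of I M '' Submodule.span R Z) =
      Submodule.span (AdicCompletion I R) (AdicCompletion.of I M '' Z) := by
  refine le_antisymm ?_ (Submodule.span_mono (Set.image_mono Submodule.subset_span))
  rw [← Submodule.map_coe, Submodule.map_span, Submodule.span_span_of_tower]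

theorem span_range_adicCompletionOf [Module.Finite R M] :
    Submodule.span (AdicCompletion I R) (Set.range (AdicCompletion.of I M)) = ⊤ := by
  refine Submodule.eq_top_iff'.2 fun x => ?_
  obtain ⟨t, rfl⟩ := AdicCompletion.ofTensorProduct_surjective_of_finite I M x
  induction t with
  | zero => exact map_zero (AdicCompletion.ofTensorProduct I M) ▸ zero_mem _
  | tmul r a =>
    rw [AdicCompletion.ofTensorProduct_tmul]
    exact Submodule.smul_mem _ r (Submodule.subset_span ⟨a, rfl⟩)
  | add s t hs ht => exact map_add (AdicCompletion.ofTensorProduct I M) s t ▸ add_mem hs ht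

theorem range_adicCompletionMap [Module.Finite R M] {N : Type*} [AddCommGroup N] [Module R N]
    (f : M →ₗ[R] N) : LinearMap.range (AdicCompletion.map I f) =
      Submodule.span (AdicCompletion I R) (AdicCompletion.of I N '' LinearMap.range f) := by
  rw [LinearMap.range_eq_map, ← span_range_adicCompletionOf, Submodule.map_span, ← Set.range_comp,
    LinearMap.coe_range, ← Set.range_comp]
  exact congrArg _ (congrArg _ (funext fun a => AdicCompletion.map_of I f a))

end AdicCompletionModule

section AdicCompletionKernel

universe u

variable {R : Type u} [CommRing R] [IsNoetherianRing R] (I : Ideal R)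
  {M N : Type u} [AddCommGroup M] [Module R M] [Module.Finite R M]
  [AddCommGroup N] [Module R N] [Module.Finite R N]

theorem ker_adicCompletionMap (f : M →ₗ[R] N) : LinearMap.ker (AdicCompletion.map I f) =
      Submodule.span (AdicCompletion I R) (AdicCompletion.of I M '' LinearMap.ker f) := by
  have hf : (LinearMap.range f).subtype ∘ₗ f.rangeRestrict = f := f.subtype_comp_codRestrict _ _
  have hexact := AdicCompletion.map_exact (I := I) (LinearMap.ker f).subtype_injective
    (f.ker_rangeRestrict ▸ f.rangeRestrict.exact_subtype_ker_map) f.surjective_rangeRestrict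
  rw [← hf, ← AdicCompletion.map_comp, LinearMap.ker_comp_of_ker_eq_bot _ (LinearMap.ker_eq_bot.2
    (AdicCompletion.map_injective I (LinearMap.range f).subtype_injective)),
    hexact.linearMap_ker_eq, range_adicCompletionMap, Submodule.range_subtype, hf]

theorem torsionOf_adicCompletion_of (x : N) :
    Ideal.torsionOf (AdicCompletion I R) (AdicCompletion I N) (AdicCompletion.of I N x) =
      (Ideal.torsionOf R N x).map (algebraMap R (AdicCompletion I R)) := by
  have h : LinearMap.toSpanSingleton (AdicCompletion I R) _ (AdicCompletion.of I N x) =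
      AdicCompletion.map I (LinearMap.toSpanSingleton R N x) := by
    refine LinearMap.ext_ring ?_
    exact (LinearMap.toSpanSingleton_apply_one _ _ _).trans
      ((congrArg _ (LinearMap.toSpanSingleton_apply_one R N x).symm).trans
        (AdicCompletion.map_of I (LinearMap.toSpanSingleton R N x) 1).symm)
  exact (congrArg LinearMap.ker h).trans (ker_adicCompletionMap I _)

end AdicCompletionKernel

theorem sup_pow_le_smul_top {R A : Type*} [CommRing R] [Ring A] [Algebra R A] (I : Ideal R)
    {V : Submodule R A} {b : ℕ} (hV : V ^ b = ⊥) (n : ℕ) :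
    (Submodule.map (Algebra.linearMap R A) I ⊔ V) ^ (n + b) ≤ I ^ n • (⊤ : Submodule R A) := by
  set E := Submodule.map (Algebra.linearMap R A) I
  have hcomm : Commute E V := Submodule.mul_comm_of_commute (by
    rintro _ ⟨r, -, rfl⟩ v -
    exact Algebra.commutes r v)
  have hE (X : Submodule R A) : E ^ n * X ≤ I ^ n • ⊤ := by
    rw [← show Submodule.map (Algebra.linearMap R A) (I ^ n) = E ^ n from
      Submodule.map_pow I (Algebra.ofId R A) n, Submodule.mul_le]
    rintro _ ⟨r, hr, rfl⟩ x -
    rw [Algebra.linearMap_apply, ← Algebra.smul_def]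
    exact Submodule.smul_mem_smul hr Submodule.mem_top
  rw [← Submodule.add_eq_sup, hcomm.add_pow]
  refine Finset.sum_induction _ (· ≤ I ^ n • (⊤ : Submodule R A)) (fun _ _ => sup_le) bot_le
    fun i _ => ?_
  rcases le_or_gt n i with hi | hi
  · rw [← Nat.add_sub_of_le hi, pow_add, mul_assoc, mul_assoc]
    exact hE _
  · rw [show n + b - i = b + (n - i) by omega, pow_add, hV, Submodule.bot_mul, Submodule.mul_bot,
      Submodule.bot_mul]
    exact bot_le

section EvenPart

variable {A : Type*} [Ring A] {𝒜 : ZMod 2 → AddSubgroup A} [GradedRing 𝒜]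

theorem proj_of_mem {i : ZMod 2} {a : A} (ha : a ∈ 𝒜 i) : GradedRing.proj 𝒜 i a = a :=
  DirectSum.decompose_of_mem_same 𝒜 ha

theorem proj_of_mem_ne {i j : ZMod 2} {a : A} (ha : a ∈ 𝒜 i) (h : i ≠ j) :
    GradedRing.proj 𝒜 j a = 0 :=
  DirectSum.decompose_of_mem_ne 𝒜 ha h

theorem odd_mul_odd_mem {a b : A} (ha : a ∈ 𝒜 1) (hb : b ∈ 𝒜 1) : a * b ∈ 𝒜 0 :=
  SetLike.mul_mem_graded ha hb

theorem even_mul_mem {i : ZMod 2} {a b : A} (ha : a ∈ 𝒜 0) (hb : b ∈ 𝒜 i) : a * b ∈ 𝒜 i := by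
  simpa only [zero_add] using SetLike.mul_mem_graded ha hb

variable (𝒜)

theorem proj_zero_mul (a b : A) : GradedRing.proj 𝒜 0 (a * b) =
    GradedRing.proj 𝒜 0 a * GradedRing.proj 𝒜 0 b +
      GradedRing.proj 𝒜 1 a * GradedRing.proj 𝒜 1 b := by
  conv_lhs => rw [← proj_add_proj 𝒜 a, add_mul, map_add]
  exact congrArg₂ _
    (DirectSum.coe_decompose_mul_of_left_mem_zero 𝒜 (proj_mem 𝒜 0 a))
    (DirectSum.coe_decompose_mul_add_of_left_mem 𝒜 (i := 1) (j := 1) (proj_mem 𝒜 1 a))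

variable [IsSuperCommutative 𝒜]

instance evenPart.instAlgebra : Algebra (evenPart 𝒜) A where
  algebraMap := (evenPart 𝒜).subtype
  commutes' r a := even_comm (𝒜 := 𝒜) r.2 a
  smul_def' _ _ := rfl

theorem proj_smul (i : ZMod 2) (r : evenPart 𝒜) (a : A) :
    GradedRing.proj 𝒜 i (r • a) = r • GradedRing.proj 𝒜 i a :=
  DirectSum.coe_decompose_mul_of_left_mem_zero 𝒜 r.2

/-- The projection to a homogeneous component, as a linear map over the even part. -/
def projLinear (i : ZMod 2) : A →ₗ[evenPart 𝒜] A where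
  toFun := GradedRing.proj 𝒜 i
  map_add' := map_add _
  map_smul' r a := proj_smul 𝒜 i r a

/-- The projection to the even part, as a linear map over the even part. -/
def evenProj : A →ₗ[evenPart 𝒜] evenPart 𝒜 where
  toFun a := ⟨GradedRing.proj 𝒜 0 a, proj_mem 𝒜 0 a⟩
  map_add' a b := Subtype.ext (map_add _ a b)
  map_smul' r a := Subtype.ext (proj_smul 𝒜 0 r a)

theorem evenProj_coe (r : evenPart 𝒜) : evenProj 𝒜 (r : A) = r :=
  Subtype.ext (proj_of_mem r.2)

/-- A homogeneous component, as a submodule over the even part. -/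
def gradedPart (i : ZMod 2) : Submodule (evenPart 𝒜) A where
  __ := 𝒜 i
  smul_mem' r _ ha := even_mul_mem r.2 ha

theorem gradedPart_sup : gradedPart 𝒜 0 ⊔ gradedPart 𝒜 1 = ⊤ := by
  refine eq_top_iff.2 fun a _ => ?_
  rw [← proj_add_proj 𝒜 a]
  exact Submodule.add_mem_sup (proj_mem 𝒜 0 a) (proj_mem 𝒜 1 a)

theorem isNoetherianSuper_of_isNoetherian [IsNoetherian (evenPart 𝒜) A] :
    IsNoetherianSuper 𝒜 :=
  have : StrictMono fun I : HomogeneousIdeal 𝒜 => I.toIdeal.restrictScalars (evenPart 𝒜) :=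
    strictMono_of_le_iff_le fun _ _ => Iff.rfl
  this.wellFoundedGT

theorem proj_mem_of_mem_span {i : ZMod 2} {N : Submodule (evenPart 𝒜) A}
    (hN : N ≤ gradedPart 𝒜 i) {x : A} (hx : x ∈ Ideal.span (N : Set A)) :
    GradedRing.proj 𝒜 i x ∈ N := by
  induction hx using Submodule.closure_induction with
  | zero => exact (map_zero (GradedRing.proj 𝒜 i)).symm ▸ zero_mem N
  | add x y _ _ hx hy => exact (map_add (GradedRing.proj 𝒜 i) x y).symm ▸ add_mem hx hy
  | smul_mem c x hx =>
    have h : GradedRing.proj 𝒜 (0 + i) (c * x) = GradedRing.proj 𝒜 0 c * x :=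
      DirectSum.coe_decompose_mul_add_of_right_mem 𝒜 (hN hx)
    rw [zero_add] at h
    exact h ▸ N.smul_mem (⟨_, proj_mem 𝒜 0 c⟩ : evenPart 𝒜) hx

variable {𝒜} in
theorem isNoetherian_gradedPart (hA : IsNoetherianSuper 𝒜) (i : ZMod 2) :
    IsNoetherian (evenPart 𝒜) (gradedPart 𝒜 i) := by
  have hA' : WellFoundedGT (HomogeneousIdeal 𝒜) := hA
  let g : Submodule (evenPart 𝒜) (gradedPart 𝒜 i) → HomogeneousIdeal 𝒜 := fun N =>
    ⟨Ideal.span (N.map (gradedPart 𝒜 i).subtype : Set A),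
      Ideal.homogeneous_span 𝒜 _ (by rintro _ ⟨x, -, rfl⟩; exact ⟨i, x.2⟩)⟩
  have hg : StrictMono g := by
    refine strictMono_of_le_iff_le fun N N' =>
      ⟨fun h => Ideal.span_mono (Submodule.map_mono h), fun h x hx => ?_⟩
    have hmem := proj_mem_of_mem_span 𝒜 (Submodule.map_subtype_le _ N')
      (h (Ideal.subset_span ⟨x, hx, rfl⟩))
    obtain ⟨y, hy, hyx⟩ := hmem
    rwa [← Subtype.ext (hyx.trans (proj_of_mem x.2))]
  exact isNoetherian_iff'.2 hg.wellFoundedGT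

variable {𝒜} in
theorem isNoetherian_evenPart (hA : IsNoetherianSuper 𝒜) : IsNoetherian (evenPart 𝒜) A := by
  have := isNoetherian_gradedPart hA 0
  have := isNoetherian_gradedPart hA 1
  rw [← isNoetherian_top_iff, ← gradedPart_sup]
  infer_instance

theorem isNoetherianRing_evenPart [IsNoetherian (evenPart 𝒜) A] :
    IsNoetherianRing (evenPart 𝒜) :=
  isNoetherian_of_injective (Algebra.linearMap (evenPart 𝒜) A) Subtype.val_injective

/-- The product of odd elements, as an alternating map over the even part. -/
noncomputable def oddProd (s : ℕ) : gradedPart 𝒜 1 [⋀^Fin s]→ₗ[evenPart 𝒜] A :=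
  (ExteriorAlgebra.lift (evenPart 𝒜) ⟨(gradedPart 𝒜 1).subtype, fun y =>
    IsSuperCommutative.odd_mul_self (𝒜 := 𝒜) (y : A) y.2⟩).toLinearMap.compAlternatingMap
      (ExteriorAlgebra.ιMulti (evenPart 𝒜) s)

theorem oddProd_apply {s : ℕ} (y : Fin s → gradedPart 𝒜 1) :
    oddProd 𝒜 s y = (List.ofFn fun i => (y i : A)).prod := by
  simp only [oddProd, LinearMap.compAlternatingMap_apply, ExteriorAlgebra.ιMulti_apply,
    AlgHom.toLinearMap_apply, map_list_prod, List.map_ofFn]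
  congr 2
  funext i
  exact ExteriorAlgebra.lift_ι_apply _ _ _ _

theorem exists_gradedPart_pow_eq_bot [IsNoetherian (evenPart 𝒜) A] :
    ∃ k, gradedPart 𝒜 1 ^ k = ⊥ := by
  obtain ⟨Z, hZ⟩ := IsNoetherian.noetherian (gradedPart 𝒜 1)
  refine ⟨Z.card + 1, ?_⟩
  rw [← hZ, Submodule.span_pow, Submodule.span_eq_bot]
  intro x hx
  obtain ⟨f, rfl⟩ := Set.mem_pow.1 hx
  have hf (i) : (f i : A) ∈ gradedPart 𝒜 1 := hZ ▸ Submodule.subset_span (f i).2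
  rw [← oddProd_apply 𝒜 fun i => (⟨f i, hf i⟩ : gradedPart 𝒜 1)]
  refine AlternatingMap.map_eq_zero_of_not_injective _ _ fun hinj => ?_
  have hinj' : Function.Injective f := fun i j hij =>
    hinj (Subtype.ext (congrArg (Subtype.val : Z → A) hij))
  simpa using Fintype.card_le_of_injective f hinj'

end EvenPart

section Local

variable {A : Type*} [Ring A] {𝒜 : ZMod 2 → AddSubgroup A} [GradedRing 𝒜] [IsSuperCommutative 𝒜]

/-- The even part of a super-ideal, an ideal of the even part of the ring. -/
def evenIdeal (m : HomogeneousIdeal 𝒜) : Ideal (evenPart 𝒜) :=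
  m.toIdeal.comap (evenPart 𝒜).subtype

theorem odd_mul_odd_mem_prime (n : Ideal (evenPart 𝒜)) [n.IsPrime] {a b : A} (ha : a ∈ 𝒜 1)
    (hb : b ∈ 𝒜 1) : (⟨a * b, odd_mul_odd_mem ha hb⟩ : evenPart 𝒜) ∈ n := by
  have hsq : (⟨a * b, odd_mul_odd_mem ha hb⟩ : evenPart 𝒜) ^ 2 = 0 := by
    refine Subtype.ext (?_ : (a * b) ^ 2 = 0)
    rw [sq, mul_assoc, ← mul_assoc b a b, odd_anticomm hb ha, neg_mul, mul_assoc a b b,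
      IsSuperCommutative.odd_mul_self b hb, mul_zero, neg_zero, mul_zero]
  exact Ideal.IsPrime.mem_of_pow_mem ‹_› 2 (hsq ▸ zero_mem n)

/-- The homomorphism from a super-ring to the quotient of its even part by a prime ideal, which
kills the odd part: a product of two odd elements squares to zero, so it lies in every prime. -/
def toEvenQuotient (n : Ideal (evenPart 𝒜)) [n.IsPrime] : A →+* evenPart 𝒜 ⧸ n where
  toFun a := Ideal.Quotient.mk n (evenProj 𝒜 a)
  map_one' := congrArg (Ideal.Quotient.mk n) (evenProj_coe 𝒜 1)
  map_mul' a b := by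
    rw [← map_mul, Ideal.Quotient.eq]
    convert odd_mul_odd_mem_prime n (proj_mem 𝒜 1 a) (proj_mem 𝒜 1 b) using 1
    exact Subtype.ext (sub_eq_of_eq_add' (proj_zero_mul 𝒜 a b))
  map_zero' := by rw [map_zero, map_zero]
  map_add' a b := by rw [map_add, map_add]

/-- The super-ideal `𝔫 ⊕ A₁` attached to a prime ideal `𝔫` of `A₀`. -/
def superIdealOfPrime (n : Ideal (evenPart 𝒜)) [n.IsPrime] : HomogeneousIdeal 𝒜 where
  toSubmodule := RingHom.ker (toEvenQuotient n)
  is_homogeneous' := by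
    intro i a (ha : Ideal.Quotient.mk n (evenProj 𝒜 a) = 0)
    change Ideal.Quotient.mk n (evenProj 𝒜 (GradedRing.proj 𝒜 i a)) = 0
    rcases zmod_two_cases i with rfl | rfl
    · rwa [show evenProj 𝒜 (GradedRing.proj 𝒜 0 a) = evenProj 𝒜 a from
        Subtype.ext (proj_of_mem (proj_mem 𝒜 0 a))]
    · rw [show evenProj 𝒜 (GradedRing.proj 𝒜 1 a) = 0 from
        Subtype.ext (proj_of_mem_ne (proj_mem 𝒜 1 a) (by decide)), map_zero]

theorem evenIdeal_superIdealOfPrime (n : Ideal (evenPart 𝒜)) [n.IsPrime] :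
    evenIdeal (superIdealOfPrime n) = n := by
  ext r
  change Ideal.Quotient.mk n (evenProj 𝒜 r) = 0 ↔ r ∈ n
  rw [evenProj_coe, Ideal.Quotient.eq_zero_iff_mem]

theorem isMaximalSuperIdeal_superIdealOfPrime (n : Ideal (evenPart 𝒜)) [n.IsMaximal] :
    IsMaximalSuperIdeal (superIdealOfPrime n) := by
  have hsurj : Function.Surjective (toEvenQuotient n) := fun x => by
    obtain ⟨r, rfl⟩ := Ideal.Quotient.mk_surjective x
    exact ⟨r, congrArg _ (evenProj_coe 𝒜 r)⟩
  exact (RingHom.quotientKerEquivOfSurjective hsurj).toMulEquiv.isField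
    ((Ideal.Quotient.maximal_ideal_iff_isField_quotient n).1 inferInstance)

theorem isLocalRing_evenPart {m : HomogeneousIdeal 𝒜} (hm : IsLocalWith 𝒜 m) :
    ∃ _ : IsLocalRing (evenPart 𝒜), IsLocalRing.maximalIdeal (evenPart 𝒜) = evenIdeal m := by
  have huniq (n : Ideal (evenPart 𝒜)) (hn : n.IsMaximal) : n = evenIdeal m := by
    rw [← hm.2 _ (isMaximalSuperIdeal_superIdealOfPrime n), evenIdeal_superIdealOfPrime]
  have : Nontrivial (A ⧸ m.toIdeal) := hm.1.nontrivial
  have : Nontrivial A := (Ideal.Quotient.mk_surjective (I := m.toIdeal)).nontrivial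
  obtain ⟨n, hn⟩ := Ideal.exists_maximal (evenPart 𝒜)
  have hlocal : IsLocalRing (evenPart 𝒜) :=
    .of_unique_max_ideal ⟨n, hn, fun n' hn' => (huniq n' hn').trans (huniq n hn).symm⟩
  exact ⟨hlocal, huniq _ inferInstance⟩

end Local

section Topology

variable {A : Type*} [Ring A] {𝒜 : ZMod 2 → AddSubgroup A} [GradedRing 𝒜] [IsSuperCommutative 𝒜]
  (m : HomogeneousIdeal 𝒜)

theorem evenIdeal_pow_le_comap (n : ℕ) :
    evenIdeal m ^ n ≤ (m.toIdeal ^ n).comap (algebraMap (evenPart 𝒜) A) :=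
  pow_le_comap_pow Ideal.map_comap_le n

theorem evenIdeal_pow_smul_top_le (n : ℕ) : evenIdeal m ^ n • (⊤ : Submodule (evenPart 𝒜) A) ≤
    (m.toIdeal ^ n).restrictScalars (evenPart 𝒜) :=
  Submodule.smul_le.2 fun r hr a _ => by
    rw [Algebra.smul_def, Algebra.commutes]
    exact Ideal.mul_mem_left _ a (evenIdeal_pow_le_comap m n hr)

theorem restrictScalars_le_map_sup_gradedPart : m.toIdeal.restrictScalars (evenPart 𝒜) ≤
    Submodule.map (Algebra.linearMap (evenPart 𝒜) A) (evenIdeal m) ⊔ gradedPart 𝒜 1 := by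
  intro a ha
  rw [← proj_add_proj 𝒜 a]
  exact Submodule.add_mem_sup ⟨⟨_, proj_mem 𝒜 0 a⟩, m.isHomogeneous 0 ha, rfl⟩ (proj_mem 𝒜 1 a)

theorem exists_pow_add_le_evenIdeal_pow_smul_top [IsNoetherian (evenPart 𝒜) A] :
    ∃ b, ∀ n, (m.toIdeal ^ (n + b)).restrictScalars (evenPart 𝒜) ≤
      evenIdeal m ^ n • (⊤ : Submodule (evenPart 𝒜) A) := by
  obtain ⟨b, hb⟩ := exists_gradedPart_pow_eq_bot 𝒜
  refine ⟨b, fun n => ?_⟩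
  rcases Nat.eq_zero_or_pos n with rfl | hn
  · rw [pow_zero, one_smul]
    exact le_top
  rw [Submodule.restrictScalars_pow (by omega)]
  exact (pow_le_pow_left' (restrictScalars_le_map_sup_gradedPart m) _).trans
    (sup_pow_le_smul_top _ hb n)

end Topology

section Comparison

variable {A : Type*} [Ring A] {𝒜 : ZMod 2 → AddSubgroup A} [GradedRing 𝒜] [IsSuperCommutative 𝒜]
  (m : HomogeneousIdeal 𝒜)

/-- The canonical homomorphism from a super-ring to its completion along a super-ideal. -/
def toCompletion : A →+* Completion m :=
  (RingHom.pi fun n => Ideal.Quotient.mk (m.toIdeal ^ n)).codRestrict (completionSubring m)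
    fun _ _ _ _ => rfl

theorem toCompletion_mem {i : ZMod 2} {a : A} (ha : a ∈ 𝒜 i) :
    toCompletion m a ∈ completionGrading m i :=
  fun _ => ⟨a, ha, rfl⟩

/-- The comparison of the adic completion of the even part, as a commutative ring, with the
even part of the completion; it is bijective if `A` is Noetherian over its even part. -/
noncomputable def completionEvenMap :
    AdicCompletion (evenIdeal m) (evenPart 𝒜) →+* evenPart (completionGrading m) :=
  RingHom.codRestrict (S := Completion m)
    ((RingHom.pi fun n => toQuotient (algebraMap (evenPart 𝒜) A)
      (evenIdeal_pow_le_comap m n)).codRestrict (completionSubring m) fun r k n h =>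
        factor_toQuotient _ (evenIdeal_pow_le_comap m k) (evenIdeal_pow_le_comap m n) h _ r)
    (evenPart (completionGrading m)) fun r n => by
      obtain ⟨a, ha⟩ := Ideal.Quotient.mk_surjective (AdicCompletion.evalₐ (evenIdeal m) n r)
      exact ⟨(a : A), a.2, congrArg (Ideal.quotientMap _ _ (evenIdeal_pow_le_comap m n)) ha⟩

theorem completionEvenMap_mk (g : AdicCompletion.AdicCauchySequence (evenIdeal m) (evenPart 𝒜))
    (n : ℕ) : (completionEvenMap m (AdicCompletion.mk _ _ g)).1.1 n =
      Ideal.Quotient.mk (m.toIdeal ^ n) (g n : A) :=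
  congrArg (Ideal.quotientMap _ _ (evenIdeal_pow_le_comap m n)) (AdicCompletion.evalₐ_mk _ n g)

/-- The `n`-th component of `completionLinearMap`. -/
noncomputable def evalQuotientPow (n : ℕ) :
    AdicCompletion (evenIdeal m) A →ₗ[evenPart 𝒜] A ⧸ m.toIdeal ^ n :=
  (Submodule.liftQ _ ((Submodule.mkQ (m.toIdeal ^ n)).restrictScalars (evenPart 𝒜))
    (by simpa using evenIdeal_pow_smul_top_le m n)).comp (AdicCompletion.eval _ _ n)

theorem evalQuotientPow_mk (f : AdicCompletion.AdicCauchySequence (evenIdeal m) A) (n : ℕ) :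
    evalQuotientPow m n (AdicCompletion.mk _ _ f) = Ideal.Quotient.mk (m.toIdeal ^ n) (f n) :=
  rfl

theorem factor_evalQuotientPow {k n : ℕ} (h : k ≤ n) (x : AdicCompletion (evenIdeal m) A) :
    Ideal.Quotient.factor (Ideal.pow_le_pow_right h) (evalQuotientPow m n x) =
      evalQuotientPow m k x := by
  obtain ⟨f, rfl⟩ := AdicCompletion.mk_surjective _ _ x
  rw [evalQuotientPow_mk, evalQuotientPow_mk, Ideal.Quotient.factor_mk, Ideal.Quotient.eq]
  exact evenIdeal_pow_smul_top_le m k (SModEq.sub_mem.1 (f.2 h).symm)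

theorem evalQuotientPow_smul (n : ℕ) (r : AdicCompletion (evenIdeal m) (evenPart 𝒜))
    (x : AdicCompletion (evenIdeal m) A) :
    evalQuotientPow m n (r • x) = (completionEvenMap m r).1.1 n * evalQuotientPow m n x := by
  obtain ⟨g, rfl⟩ := AdicCompletion.mk_surjective _ _ r
  obtain ⟨f, rfl⟩ := AdicCompletion.mk_surjective _ _ x
  rw [completionEvenMap_mk, evalQuotientPow_mk]
  rfl

/-- The comparison of the adic completion of a super-ring, as a module over its even part, with
its completion as a super-ring; it is bijective if `A` is Noetherian over its even part. -/
noncomputable def completionLinearMap :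
    AdicCompletion (evenIdeal m) A →ₛₗ[completionEvenMap m] Completion m where
  toFun x := ⟨fun n => evalQuotientPow m n x, fun _ _ h => factor_evalQuotientPow m h x⟩
  map_add' x y := Subtype.ext (funext fun n => map_add (evalQuotientPow m n) x y)
  map_smul' r x := Subtype.ext (funext fun n => evalQuotientPow_smul m n r x)

theorem completionLinearMap_mk (f : AdicCompletion.AdicCauchySequence (evenIdeal m) A)
    (n : ℕ) : (completionLinearMap m (AdicCompletion.mk _ _ f)).1 n =
      Ideal.Quotient.mk (m.toIdeal ^ n) (f n) :=
  rfl

theorem completionLinearMap_of (a : A) :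
    completionLinearMap m (AdicCompletion.of _ A a) = toCompletion m a :=
  rfl

theorem completionLinearMap_injective [IsNoetherian (evenPart 𝒜) A] :
    Function.Injective (completionLinearMap m) := by
  obtain ⟨b, hb⟩ := exists_pow_add_le_evenIdeal_pow_smul_top m
  refine (injective_iff_map_eq_zero _).2 fun x hx => ?_
  obtain ⟨f, rfl⟩ := AdicCompletion.mk_surjective _ _ x
  have hf (n : ℕ) : f n ∈ m.toIdeal ^ n := by
    rw [← Ideal.Quotient.eq_zero_iff_mem, ← completionLinearMap_mk, hx]
    rfl
  exact AdicCompletion.mk_zero_of _ _ f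
    ⟨0, fun n _ => ⟨n + b, Nat.le_add_right n b, n, le_rfl, hb n (hf (n + b))⟩⟩

theorem completionLinearMap_surjective [IsNoetherian (evenPart 𝒜) A] :
    Function.Surjective (completionLinearMap m) := by
  obtain ⟨b, hb⟩ := exists_pow_add_le_evenIdeal_pow_smul_top m
  intro x
  choose a ha using fun n => Ideal.Quotient.mk_surjective (x.1 n)
  have hfactor {k n : ℕ} (h : k ≤ n) : Ideal.Quotient.mk (m.toIdeal ^ k) (a n) = x.1 k := by
    rw [← x.2 k n h, ← ha n, Ideal.Quotient.factor_mk]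
  let f := AdicCompletion.AdicCauchySequence.mk (evenIdeal m) A (fun n => a (n + b)) fun n =>
    SModEq.sub_mem.2 <| hb n <| Ideal.Quotient.eq.1 <|
      (ha (n + b)).trans (hfactor (Nat.add_le_add_right n.le_succ b)).symm
  exact ⟨AdicCompletion.mk _ _ f,
    Subtype.ext (funext fun n => hfactor (Nat.le_add_right n b))⟩

theorem completionLinearMap_map_projLinear_mem (i : ZMod 2) (x : AdicCompletion (evenIdeal m) A) :
    completionLinearMap m (AdicCompletion.map _ (projLinear 𝒜 i) x) ∈ completionGrading m i := by
  obtain ⟨f, rfl⟩ := AdicCompletion.mk_surjective _ _ x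
  exact fun n => ⟨_, proj_mem 𝒜 i (f n), rfl⟩

theorem proj_completionLinearMap (i : ZMod 2) (x : AdicCompletion (evenIdeal m) A) :
    GradedRing.proj (completionGrading m) i (completionLinearMap m x) =
      completionLinearMap m (AdicCompletion.map _ (projLinear 𝒜 i) x) := by
  have hsum : completionLinearMap m (AdicCompletion.map _ (projLinear 𝒜 0) x) +
      completionLinearMap m (AdicCompletion.map _ (projLinear 𝒜 1) x) =
        completionLinearMap m x := by
    obtain ⟨f, rfl⟩ := AdicCompletion.mk_surjective _ _ x
    exact Subtype.ext (funext fun n => congrArg (Ideal.Quotient.mk (m.toIdeal ^ n))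
      (proj_add_proj 𝒜 (f n)))
  have hmem := completionLinearMap_map_projLinear_mem m (x := x)
  rw [← hsum, map_add]
  rcases zmod_two_cases i with rfl | rfl
  · rw [proj_of_mem (hmem 0), proj_of_mem_ne (hmem 1) (by decide), add_zero]
  · rw [proj_of_mem (hmem 1), proj_of_mem_ne (hmem 0) (by decide), zero_add]

theorem coe_completionEvenMap (r : AdicCompletion (evenIdeal m) (evenPart 𝒜)) :
    (completionEvenMap m r : Completion m) =
      completionLinearMap m (AdicCompletion.map _ (Algebra.linearMap (evenPart 𝒜) A) r) := by
  obtain ⟨g, rfl⟩ := AdicCompletion.mk_surjective _ _ r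
  exact Subtype.ext (funext (completionEvenMap_mk m g))

theorem completionEvenMap_injective [IsNoetherian (evenPart 𝒜) A] :
    Function.Injective (completionEvenMap m) := by
  have hinv : Function.LeftInverse (AdicCompletion.map (evenIdeal m) (evenProj 𝒜))
      (AdicCompletion.map _ (Algebra.linearMap (evenPart 𝒜) A)) := fun r => by
    rw [AdicCompletion.map_comp_apply, show evenProj 𝒜 ∘ₗ Algebra.linearMap (evenPart 𝒜) A =
      LinearMap.id from LinearMap.ext (evenProj_coe 𝒜), AdicCompletion.map_id, LinearMap.id_apply]
  refine .of_comp (f := Subtype.val) ?_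
  rw [show Subtype.val ∘ completionEvenMap m = completionLinearMap m ∘ AdicCompletion.map _
    (Algebra.linearMap (evenPart 𝒜) A) from funext (coe_completionEvenMap m)]
  exact (completionLinearMap_injective m).comp hinv.injective

theorem completionEvenMap_surjective [IsNoetherian (evenPart 𝒜) A] :
    Function.Surjective (completionEvenMap m) := by
  intro s
  obtain ⟨x, hx⟩ := completionLinearMap_surjective m s
  refine ⟨AdicCompletion.map _ (evenProj 𝒜) x, Subtype.ext ?_⟩
  rw [coe_completionEvenMap, AdicCompletion.map_comp_apply,
    show Algebra.linearMap (evenPart 𝒜) A ∘ₗ evenProj 𝒜 = projLinear 𝒜 0 from rfl,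
    ← proj_completionLinearMap, hx, proj_of_mem s.2]

theorem completionEvenMap_bijective [IsNoetherian (evenPart 𝒜) A] :
    Function.Bijective (completionEvenMap m) :=
  ⟨completionEvenMap_injective m, completionEvenMap_surjective m⟩

end Comparison

section Transfer

variable {A : Type*} [Ring A] {𝒜 : ZMod 2 → AddSubgroup A} [GradedRing 𝒜] [IsSuperCommutative 𝒜]
  (m : HomogeneousIdeal 𝒜)

instance completionEvenMap.instRingHomSurjective [IsNoetherian (evenPart 𝒜) A] :
    RingHomSurjective (completionEvenMap m) :=
  ⟨completionEvenMap_surjective m⟩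

theorem span_image_toCompletion [IsNoetherian (evenPart 𝒜) A] (Z : Set A) :
    Submodule.span (evenPart (completionGrading m)) (toCompletion m '' Z) =
      (Submodule.span (AdicCompletion (evenIdeal m) (evenPart 𝒜))
        (AdicCompletion.of (evenIdeal m) A '' Z)).map (completionLinearMap m) := by
  simp only [Submodule.map_span, Set.image_image, completionLinearMap_of]

theorem isNoetherian_completion [IsNoetherian (evenPart 𝒜) A] :
    IsNoetherian (evenPart (completionGrading m)) (Completion m) := by
  have := isNoetherianRing_evenPart 𝒜
  have := isNoetherianRing_adicCompletion (evenIdeal m)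
  have : Module.Finite (AdicCompletion (evenIdeal m) (evenPart 𝒜))
      (AdicCompletion (evenIdeal m) A) :=
    .of_surjective _ (AdicCompletion.ofTensorProduct_surjective_of_finite _ _)
  exact isNoetherian_of_surjective (completionLinearMap m)
    (LinearMap.range_eq_top.2 (completionLinearMap_surjective m))

theorem range_projLinear (i : ZMod 2) : LinearMap.range (projLinear 𝒜 i) = gradedPart 𝒜 i :=
  le_antisymm (by rintro _ ⟨a, rfl⟩; exact proj_mem 𝒜 i a) fun a ha => ⟨a, proj_of_mem ha⟩

theorem gradedPart_completion [IsNoetherian (evenPart 𝒜) A] {i : ZMod 2} {Z : Set A}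
    (hZ : gradedPart 𝒜 i = Submodule.span (evenPart 𝒜) Z) :
    gradedPart (completionGrading m) i =
      Submodule.span (evenPart (completionGrading m)) (toCompletion m '' Z) := by
  refine le_antisymm (fun x hx => ?_) (Submodule.span_le.2 ?_)
  · obtain ⟨y, rfl⟩ := completionLinearMap_surjective m x
    rw [span_image_toCompletion, ← span_adicCompletionOf_image_span, ← hZ, ← range_projLinear,
      ← range_adicCompletionMap]
    exact ⟨_, ⟨y, rfl⟩, (proj_completionLinearMap m i y).symm.trans (proj_of_mem hx)⟩
  · rintro _ ⟨z, hz, rfl⟩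
    exact toCompletion_mem m (hZ.ge (Submodule.subset_span hz))

theorem comap_evenAnn_toCompletion [IsNoetherian (evenPart 𝒜) A] (z : A) :
    (evenAnn (completionGrading m) (toCompletion m z)).comap (completionEvenMap m) =
      (evenAnn 𝒜 z).map (algebraMap _ (AdicCompletion (evenIdeal m) (evenPart 𝒜))) := by
  have := isNoetherianRing_evenPart 𝒜
  refine Eq.trans ?_ (torsionOf_adicCompletion_of (evenIdeal m) z)
  ext r
  rw [Ideal.mem_torsionOf_iff, ← map_eq_zero_iff _ (completionLinearMap_injective m),
    map_smulₛₗ, completionLinearMap_of]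
  rfl

variable {m}

theorem ringKrullDim_quotient_evenAnn [IsNoetherian (evenPart 𝒜) A] (hm : IsLocalWith 𝒜 m)
    (z : A) : ringKrullDim (evenPart 𝒜 ⧸ evenAnn 𝒜 z) =
      ringKrullDim (evenPart (completionGrading m) ⧸
        evenAnn (completionGrading m) (toCompletion m z)) := by
  have := isNoetherianRing_evenPart 𝒜
  obtain ⟨_, hmax⟩ := isLocalRing_evenPart hm
  rw [ringKrullDim_quotient_eq_adicCompletion, hmax, ← comap_evenAnn_toCompletion]
  exact ringKrullDim_eq_of_ringEquiv (Ideal.quotientEquiv _ _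
    (RingEquiv.ofBijective _ (completionEvenMap_bijective m))
    (Ideal.map_comap_of_surjective _ (completionEvenMap_surjective m) _).symm)

theorem evenAnn_one : evenAnn 𝒜 (1 : A) = ⊥ := by
  ext r
  exact (mul_one (r : A)).congr_left.trans (Subring.coe_eq_zero_iff _)

theorem ringKrullDim_quotient_evenAnn_one :
    ringKrullDim (evenPart 𝒜 ⧸ evenAnn 𝒜 (1 : A)) = ringKrullDim (evenPart 𝒜) := by
  rw [evenAnn_one]
  exact ringKrullDim_eq_of_ringEquiv (RingEquiv.quotientBot (evenPart 𝒜))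

theorem ringKrullDim_evenPart_completion [IsNoetherian (evenPart 𝒜) A] (hm : IsLocalWith 𝒜 m) :
    ringKrullDim (evenPart 𝒜) = ringKrullDim (evenPart (completionGrading m)) := by
  have h := ringKrullDim_quotient_evenAnn hm (1 : A)
  rwa [map_one, ringKrullDim_quotient_evenAnn_one, ringKrullDim_quotient_evenAnn_one] at h

end Transfer

section OddParameters

open scoped Pointwise

variable {A : Type*} [Ring A] {𝒜 : ZMod 2 → AddSubgroup A} [GradedRing 𝒜] [IsSuperCommutative 𝒜]

theorem evenAnn_zero : evenAnn 𝒜 (0 : A) = ⊤ :=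
  eq_top_iff.2 fun r _ => mul_zero (r : A)

theorem mem_evenAnn_of_mem_span {Z : Set A} {r : evenPart 𝒜} (hr : ∀ z ∈ Z, r ∈ evenAnn 𝒜 z)
    {x : A} (hx : x ∈ Submodule.span (evenPart 𝒜) Z) : r ∈ evenAnn 𝒜 x :=
  (Submodule.span_le (p := LinearMap.ker (LinearMap.lsmul (evenPart 𝒜) A r))).2 hr hx

theorem prod_ofFn_mem_pow {s : ℕ} {y : Fin s → A} {N : Submodule (evenPart 𝒜) A}
    (hy : ∀ i, y i ∈ N) : (List.ofFn y).prod ∈ N ^ s :=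
  Submodule.pow_subset_pow _ (Set.mem_pow.2 ⟨fun i => ⟨y i, hy i⟩, rfl⟩)

theorem exists_isSystemOfOddParameters_of_span [FiniteRingKrullDim (evenPart 𝒜)] {Z : Set A}
    (hZ : Z.Finite) (hspan : gradedPart 𝒜 1 = Submodule.span (evenPart 𝒜) Z) {s : ℕ}
    {y : Fin s → A} (hy : IsSystemOfOddParameters 𝒜 y) :
    ∃ z : Fin s → A, (∀ i, z i ∈ Z) ∧ IsSystemOfOddParameters 𝒜 z := by
  have hprod : (List.ofFn y).prod ∈ Submodule.span (evenPart 𝒜) (Z ^ s) := by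
    rw [← Submodule.span_pow, ← hspan]
    exact prod_ofFn_mem_pow hy.1
  have hfin : (Z ^ s).Finite := by
    classical
    lift Z to Finset A using hZ
    exact Finset.coe_pow Z s ▸ (Z ^ s).finite_toSet
  obtain ⟨w, hw, hdim⟩ := exists_ringKrullDim_quotient_eq hfin.toFinset (evenAnn 𝒜)
    (fun r hr => mem_evenAnn_of_mem_span
      (fun x hx => (Submodule.mem_finsetInf.1 hr) x (hfin.mem_toFinset.2 hx)) hprod) hy.2
  obtain ⟨z, rfl⟩ := Set.mem_pow.1 (hfin.mem_toFinset.1 hw)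
  exact ⟨fun i => z i, fun i => (z i).2, fun i => hspan.ge (Submodule.subset_span (z i).2), hdim⟩

variable {m : HomogeneousIdeal 𝒜}

theorem toCompletion_prod_ofFn {s : ℕ} (y : Fin s → A) :
    toCompletion m (List.ofFn y).prod = (List.ofFn fun i => toCompletion m (y i)).prod := by
  rw [map_list_prod, List.map_ofFn]
  rfl

theorem isSystemOfOddParameters_toCompletion_iff [IsNoetherian (evenPart 𝒜) A]
    (hm : IsLocalWith 𝒜 m) {s : ℕ} {y : Fin s → A} (hy : ∀ i, y i ∈ 𝒜 1) :
    IsSystemOfOddParameters (completionGrading m) (fun i => toCompletion m (y i)) ↔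
      IsSystemOfOddParameters 𝒜 y := by
  refine and_congr (iff_of_true (fun i => toCompletion_mem m (hy i)) hy) ?_
  rw [← ringKrullDim_evenPart_completion hm, ← toCompletion_prod_ofFn,
    ← ringKrullDim_quotient_evenAnn hm]

theorem finiteRingKrullDim_evenPart [IsNoetherian (evenPart 𝒜) A] (hm : IsLocalWith 𝒜 m) :
    FiniteRingKrullDim (evenPart 𝒜) := by
  have := isNoetherianRing_evenPart 𝒜
  obtain ⟨_, -⟩ := isLocalRing_evenPart hm
  infer_instance

theorem exists_isSystemOfOddParameters_completion_iff [IsNoetherian (evenPart 𝒜) A]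
    (hm : IsLocalWith 𝒜 m) (s : ℕ) :
    (∃ y : Fin s → Completion m, IsSystemOfOddParameters (completionGrading m) y) ↔
      ∃ y : Fin s → A, IsSystemOfOddParameters 𝒜 y := by
  refine ⟨fun ⟨y, hy⟩ => ?_, fun ⟨y, hy⟩ =>
    ⟨_, (isSystemOfOddParameters_toCompletion_iff hm hy.1).2 hy⟩⟩
  have := finiteRingKrullDim_evenPart hm
  have : FiniteRingKrullDim (evenPart (completionGrading m)) := by
    rw [finiteRingKrullDim_iff_ne_bot_and_top, ← ringKrullDim_evenPart_completion hm]
    exact ⟨ringKrullDim_ne_bot, ringKrullDim_ne_top⟩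
  obtain ⟨Z, hZ⟩ := IsNoetherian.noetherian (gradedPart 𝒜 1)
  obtain ⟨z, hzZ, hz⟩ := exists_isSystemOfOddParameters_of_span
    (Z.finite_toSet.image (toCompletion m)) (gradedPart_completion m hZ.symm) hy
  choose y hyZ hyz using hzZ
  obtain rfl : (fun i => toCompletion m (y i)) = z := funext hyz
  exact ⟨y, (isSystemOfOddParameters_toCompletion_iff hm fun i =>
    hZ.le (Submodule.subset_span (hyZ i))).1 hz⟩

theorem oddKrullDim_completion [IsNoetherian (evenPart 𝒜) A] (hm : IsLocalWith 𝒜 m) :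
    oddKrullDim (completionGrading m) = oddKrullDim 𝒜 := by
  simp only [oddKrullDim, exists_isSystemOfOddParameters_completion_iff hm]

theorem not_isSystemOfOddParameters_of_gradedPart_pow_eq_bot [Nontrivial (evenPart 𝒜)] {s : ℕ}
    (h : gradedPart 𝒜 1 ^ s = ⊥) (y : Fin s → A) : ¬ IsSystemOfOddParameters 𝒜 y := by
  rintro ⟨hy, hdim⟩
  have hprod : (List.ofFn y).prod ∈ gradedPart 𝒜 1 ^ s := prod_ofFn_mem_pow hy
  rw [h, Submodule.mem_bot] at hprod
  rw [hprod, evenAnn_zero] at hdim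
  exact (ringKrullDim_nonneg_of_nontrivial.trans_eq hdim).not_gt
    (ringKrullDim_eq_bot_of_subsingleton.trans_lt (WithBot.bot_lt_coe 0))

theorem oddKrullDim_ne_top [IsNoetherian (evenPart 𝒜) A] [Nontrivial (evenPart 𝒜)] :
    oddKrullDim 𝒜 ≠ ⊤ := by
  obtain ⟨k, hk⟩ := exists_gradedPart_pow_eq_bot 𝒜
  refine ne_top_of_le_ne_top (ENat.natCast_ne_top k) (iSup₂_le fun s ⟨y, hy⟩ => ?_)
  by_contra! hks
  refine not_isSystemOfOddParameters_of_gradedPart_pow_eq_bot ?_ y hy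
  rw [← Nat.add_sub_of_le (Nat.cast_lt.1 hks).le, pow_add, hk, Submodule.bot_mul]

end OddParameters

end SuperRing

theorem mainTheorem5 {A : Type*} [Ring A] (𝒜 : ZMod 2 → AddSubgroup A) [GradedRing 𝒜]
    [IsSuperCommutative 𝒜] (hA : SuperRing.IsNoetherianSuper 𝒜)
    (m : HomogeneousIdeal 𝒜) (hm : SuperRing.IsLocalWith 𝒜 m) :
    SuperRing.IsNoetherianSuper (SuperRing.completionGrading m) ∧
    (∃ r s : ℕ, SuperRing.Ksdim 𝒜 = ((r : WithBot ℕ∞), (s : ℕ∞))) ∧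
    SuperRing.Ksdim 𝒜 = SuperRing.Ksdim (SuperRing.completionGrading m) ∧
    SuperRing.evenKrullDim 𝒜 = SuperRing.evenKrullDim (SuperRing.completionGrading m) ∧
    SuperRing.oddKrullDim 𝒜 = SuperRing.oddKrullDim (SuperRing.completionGrading m) := by
  have := SuperRing.isNoetherian_evenPart hA
  have := SuperRing.isNoetherian_completion m
  have hfin := SuperRing.finiteRingKrullDim_evenPart hm
  have := Nontrivial.of_finiteRingKrullDim (R := SuperRing.evenPart 𝒜)
  have heven : SuperRing.evenKrullDim 𝒜 =
      SuperRing.evenKrullDim (SuperRing.completionGrading m) :=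
    SuperRing.ringKrullDim_evenPart_completion hm
  have hodd : SuperRing.oddKrullDim 𝒜 =
      SuperRing.oddKrullDim (SuperRing.completionGrading m) :=
    (SuperRing.oddKrullDim_completion hm).symm
  obtain ⟨r, hr⟩ : ∃ r : ℕ, SuperRing.evenKrullDim 𝒜 = r :=
    ⟨_, Order.krullDim_eq_length_of_finiteDimensionalOrder⟩
  obtain ⟨s, hs⟩ := ENat.ne_top_iff_exists.1 (SuperRing.oddKrullDim_ne_top (𝒜 := 𝒜))
  exact ⟨SuperRing.isNoetherianSuper_of_isNoetherian _, ⟨r, s, Prod.ext hr hs.symm⟩,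
    Prod.ext heven hodd, heven, hodd⟩
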